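/- Let $\mathbb F_q$ be a finite field and let $Q=(q_{ij})\in\mathbb F_q^{2\times 2}$. Consider the memoryless two-user interference channel $$y_{k,t}=q_{k1}x_{1,t}+q_{k2}x_{2,t}+\zeta_{k,t}\in\mathbb F_q,\qquad k=1,2,\quad t=1,\dots,n,$$ where $q_{kj}$ is the coefficient from transmitter $j$ to receiver $k$, and the noise pairs $(\zeta_{1,t},\zeta_{2,t})$ are i.i.d. over time $t$, independent of the messages, with an arbitrary (known) law on $\mathbb F_q^2$; $H(\zeta_k)$ denotes the entropy of the $k$-th component. Logarithms are to base 2. In the finite-field Network-Coded cognitive interference channel the messages $w_1,w_2$ are independent, $w_k$ uniform on $\mathbb F_q^{r_k}$, and each is zero-padded to length $r=\max(r_1,r_2)$. Transmitter 1 knows $(w_1,w_2)$, transmitter 2 knows only the sum $w_1+w_2\in\mathbb F_q^{r}$ of the padded messages, and receiver $k$ estimates $w_k$ from $y_{k,1},\dots,y_{k,n}$. A pair $(R_1,R_2)$ of non-negative reals is achievable if there are codes of every block length $n$ with $r_k\log q\ge nR_k$ for which $\Pr(\hat w_k\ne w_k)\to0$ as $n\to\infty$, for both $k=1,2$. The capacity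 region is the closure of the set of achievable rate pairs. In the corresponding vector broadcast channel (full cooperation) both inputs $x_1,x_2$ are chosen jointly as a function of both messages, user $k$'s message being uniform on a set of size at least $2^{nR_k}$. **Theorem.** Suppose $\det Q\ne0$, $q_{11}\ne0$ and $q_{21}\ne0$. Then the capacity region of the finite-field Network-Coded cognitive interference channel is $$\{(R_1,R_2): 0\le R_k\le \log q-H(\zeta_k),\ k=1,2\},$$ and it equals the capacity region of the corresponding vector broadcast channel. Moreover, this region is attained by distributed zero-forcing precoding: there are $m_1,m_2,m_3\in\mathbb F_q$ with $$q_{11}m_2+q_{12}m_3=0,\quad q_{21}m_1+q_{22}m_3=0,\quad q_{11}m_1+q_{12}m_3\ne0,\quad q_{21}m_2+q_{22}m_3\ne0,$$ such that the capacity region is the closure of the set of rate pairs achievable by codes of the following form: for a full-rank matrix $G\in\mathbb F_q^{r\times n}$ and $c_k=w_kG$ (with $w_k$ zero-padded), transmitter 1 sends $m_1c_1+m_2c_2$ and transmitter 2 sends $m_3(w_1+w_2)G=m_3(c_1+c_2)$. -/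

import Mathlib

open Matrix Filter Topology

namespace NetworkCodedCIC

noncomputable section

/-- Shannon entropy, in bits, of a probability mass function on a finite set. -/
def entropy {A : Type*} [Fintype A] (p : PMF A) : ℝ :=
  -∑ a, (p a).toReal * Real.logb 2 (p a).toReal

/-- The law of the `k`-th noise component `ζ_k` when the pair `(ζ_1, ζ_2)` has law `P`
(the two users are indexed by `0, 1 : Fin 2`). -/
def marginal {F : Type*} (P : PMF (Fin 2 → F)) (k : Fin 2) : PMF F :=
  P.map (fun z => z k)

/-- The block received by receiver `k`: `y_k = q_{k1} x_1 + q_{k2} x_2 + ζ_k` at every time `t`.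
Here `x j t` is the symbol sent by transmitter `j` at time `t`, and `z t k` is the noise at
receiver `k` at time `t`. -/
def received {F : Type*} [Field F] {n : ℕ} (Q : Matrix (Fin 2) (Fin 2) F)
    (x : Fin 2 → Fin n → F) (z : Fin n → Fin 2 → F) (k : Fin 2) : Fin n → F :=
  fun t => (Q *ᵥ fun j => x j t) k + z t k

open Classical in
/-- The average probability that receiver `k` decodes its message wrongly: the message pair is
uniform on `W 0 × W 1`, the noise pairs `(z t 0, z t 1)` are i.i.d. over time with law `P` and
independent of the messages, `enc w` is the pair of transmitted blocks. -/
def errorProb {F : Type*} [Field F] [Fintype F] {n : ℕ} (Q : Matrix (Fin 2) (Fin 2) F)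
    (P : PMF (Fin 2 → F)) {W : Fin 2 → Type*} [∀ k, Fintype (W k)]
    (enc : (∀ k, W k) → Fin 2 → Fin n → F) (dec : ∀ k, (Fin n → F) → W k) (k : Fin 2) : ℝ :=
  (∑ w : ∀ k, W k, ∑ z : Fin n → Fin 2 → F,
    if dec k (received Q (enc w) z k) = w k then 0 else ∏ t, (P (z t)).toReal) /
      Fintype.card (∀ k, W k)

/-! ### The interference channel with network-coded cognition -/

/-- Zero padding of a message of length `m` to length `r` (used with `m ≤ r`). -/
def zeroPad {F : Type*} [Field F] {m : ℕ} (r : ℕ) (w : Fin m → F) : Fin r → F :=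
  fun i => if h : (i : ℕ) < m then w ⟨i, h⟩ else 0

/-- The message of user `k`, zero-padded to the common length `max (r 0) (r 1)`. -/
def padded {F : Type*} [Field F] {r : Fin 2 → ℕ} (w : ∀ k, Fin (r k) → F) (k : Fin 2) :
    Fin (max (r 0) (r 1)) → F :=
  zeroPad (max (r 0) (r 1)) (w k)

/-- A code of block length `n` for messages `w_k ∈ F^{r_k}`. Transmitter 1 sees both messages,
transmitter 2 sees a vector that will be the sum of the two zero-padded messages, and receiver `k`
estimates `w_k` from its own received block. -/
structure Code (F : Type*) (n : ℕ) (r : Fin 2 → ℕ) where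
  enc₁ : (∀ k, Fin (r k) → F) → Fin n → F
  enc₂ : (Fin (max (r 0) (r 1)) → F) → Fin n → F
  dec : ∀ k, (Fin n → F) → Fin (r k) → F

/-- The pair of blocks sent for the messages `w`. -/
def Code.encode {F : Type*} [Field F] {n : ℕ} {r : Fin 2 → ℕ} (c : Code F n r)
    (w : ∀ k, Fin (r k) → F) : Fin 2 → Fin n → F :=
  ![c.enc₁ w, c.enc₂ (padded w 0 + padded w 1)]

/-- The rate pair `R` (bits per channel use) is achievable by codes of the class `S`: for every
block length `n` there is such a code whose `k`-th message carries at least `n R_k` bits, and the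
error probabilities of both receivers tend to zero. -/
def AchievableBy {F : Type*} [Field F] [Fintype F] (Q : Matrix (Fin 2) (Fin 2) F)
    (P : PMF (Fin 2 → F)) (S : ∀ {n : ℕ} {r : Fin 2 → ℕ}, Code F n r → Prop)
    (R : Fin 2 → ℝ) : Prop :=
  (∀ k, 0 ≤ R k) ∧
    ∃ (r : ℕ → Fin 2 → ℕ) (c : ∀ n, Code F n (r n)),
      (∀ n, S (c n)) ∧
      (∀ (n : ℕ) (k : Fin 2), (n : ℝ) * R k ≤ (r n k : ℝ) * Real.logb 2 (Fintype.card F)) ∧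
      ∀ k, Tendsto (fun n => errorProb Q P (c n).encode (c n).dec k) atTop (𝓝 0)

/-- The capacity region of the finite-field network-coded cognitive interference channel: the
closure of the set of all achievable rate pairs. -/
def capacityRegion {F : Type*} [Field F] [Fintype F] (Q : Matrix (Fin 2) (Fin 2) F)
    (P : PMF (Fin 2 → F)) : Set (Fin 2 → ℝ) :=
  closure {R | AchievableBy Q P (fun _ => True) R}

/-- Codes using distributed precoding with coefficients `m = (m_1, m_2, m_3)`: for one full-rank
generator matrix `G` and the codewords `c_k = w_k G` of the zero-padded messages, transmitter 1
sends `m_1 c_1 + m_2 c_2`, and transmitter 2 sends `m_3 (c_1 + c_2) = m_3 (w_1 + w_2) G`. -/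
def IsPrecodedLinear {F : Type*} [Field F] (m : Fin 3 → F) {n : ℕ} {r : Fin 2 → ℕ}
    (c : Code F n r) : Prop :=
  ∃ G : Matrix (Fin (max (r 0) (r 1))) (Fin n) F,
    LinearIndependent F G.row ∧
    (∀ w, c.enc₁ w = m 0 • (padded w 0 ᵥ* G) + m 1 • (padded w 1 ᵥ* G)) ∧
    ∀ v, c.enc₂ v = m 2 • (v ᵥ* G)

/-- The closure of the set of rate pairs achievable by distributed precoding with the fixed
coefficients `m` and linear codes. -/
def precodingRegion {F : Type*} [Field F] [Fintype F] (Q : Matrix (Fin 2) (Fin 2) F)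
    (P : PMF (Fin 2 → F)) (m : Fin 3 → F) : Set (Fin 2 → ℝ) :=
  closure {R | AchievableBy Q P (fun c => IsPrecodedLinear m c) R}

/-- The zero-forcing conditions on `m`: with precoding, receiver `k` sees
`λ_{k1} c_1 + λ_{k2} c_2 + ζ_k`; the interference coefficients `λ_12, λ_21` must vanish, and the
coefficients `λ_11, λ_22` of the desired codewords must not. -/
def IsZeroForcing {F : Type*} [Field F] (Q : Matrix (Fin 2) (Fin 2) F) (m : Fin 3 → F) : Prop :=
  Q 0 0 * m 1 + Q 0 1 * m 2 = 0 ∧ Q 1 0 * m 0 + Q 1 1 * m 2 = 0 ∧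
    Q 0 0 * m 0 + Q 0 1 * m 2 ≠ 0 ∧ Q 1 0 * m 1 + Q 1 1 * m 2 ≠ 0

/-! ### The vector broadcast channel (full transmitter cooperation) -/

/-- A code of block length `n` for the two-user broadcast channel with private messages in sets of
sizes `M 0`, `M 1`: one encoder, knowing both messages, chooses both transmitted blocks. -/
structure BCCode (F : Type*) (n : ℕ) (M : Fin 2 → ℕ) where
  enc : (∀ k, Fin (M k)) → Fin 2 → Fin n → F
  dec : ∀ k, (Fin n → F) → Fin (M k)

/-- Achievability of the rate pair `R` (bits per channel use) over the broadcast channel. -/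
def BCAchievable {F : Type*} [Field F] [Fintype F] (Q : Matrix (Fin 2) (Fin 2) F)
    (P : PMF (Fin 2 → F)) (R : Fin 2 → ℝ) : Prop :=
  (∀ k, 0 ≤ R k) ∧
    ∃ (M : ℕ → Fin 2 → ℕ) (c : ∀ n, BCCode F n (M n)),
      (∀ (n : ℕ) (k : Fin 2), (2 : ℝ) ^ ((n : ℝ) * R k) ≤ (M n k : ℝ)) ∧
      ∀ k, Tendsto (fun n => errorProb Q P (c n).enc (c n).dec k) atTop (𝓝 0)

/-- The capacity region of the finite-field vector broadcast channel. -/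
def bcCapacityRegion {F : Type*} [Field F] [Fintype F] (Q : Matrix (Fin 2) (Fin 2) F)
    (P : PMF (Fin 2 → F)) : Set (Fin 2 → ℝ) :=
  closure {R | BCAchievable Q P R}

end

end NetworkCodedCIC

namespace NetworkCodedCIC

/-! The proof is a cycle of inclusions: box ⊆ precoding region ⊆ capacity region ⊆ broadcast region
⊆ box. The two middle ones are formal, since each class of codes embeds in the next.

Converse (`BCAchievable.le`): each receiver is treated alone, so full cooperation does not matter.
The noise is additive, hence a message is decoded correctly exactly when the noise lies in a
translate of its decoding region. For `h < H(ζ_k)` a set of blocks has noise mass at most `2 ^ (-n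
h)` times its size, up to a vanishing error, and the decoding regions partition `F ^ n`. With `M`
messages the success probability is thus about `q ^ n 2 ^ (-n h) / M` at most, which tends to zero
above the claimed rate. This replaces Fano's inequality.

Direct part (`achievableBy_isPrecodedLinear`): encoding is linear, so the sum `w_1 + w_2` gives
transmitter 2 exactly `c_1 + c_2`, enough to cancel the interference at both receivers. Each then
sees a nonzero multiple of its own codeword plus noise. A random generator matrix with typical-set
decoding makes the average error small below capacity; since both receivers share one `G`, their
union bounds and the rank-deficiency indicator are averaged together (`exists_generator`).

Both halves rest on one Chernoff bound (`exists_chernoff`), applied to `∓log p` shifted by `h`. -/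

/-! ### Block laws of memoryless sources -/

/-- The probability of the block `u` under the `n`-fold product of the weights `p`. -/
noncomputable def blockMass {A : Type*} {n : ℕ} (p : A → ℝ) (u : Fin n → A) : ℝ := ∏ t, p (u t)

lemma blockMass_nonneg {A : Type*} {n : ℕ} {p : A → ℝ} (hp : ∀ a, 0 ≤ p a) (u : Fin n → A) :
    0 ≤ blockMass p u :=
  Finset.prod_nonneg fun _ _ => hp _

lemma sum_blockMass {A : Type*} [Fintype A] {p : A → ℝ} (hp : ∑ a, p a = 1) (n : ℕ) :
    ∑ u : Fin n → A, blockMass p u = 1 := by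
  classical
  have := Finset.prod_univ_sum (fun _ : Fin n => (Finset.univ : Finset A)) (fun _ a => p a)
  simp only [hp, Finset.prod_const_one, Fintype.piFinset_univ] at this
  exact this.symm

/-- A sum of blockwise functionals of `g ∘ z` may be computed under the image weights. -/
lemma sum_comp_mul_prod {A B : Type*} [Fintype A] [Fintype B] [DecidableEq B] {n : ℕ} (g : A → B)
    (P : A → ℝ) (f : (Fin n → B) → ℝ) :
    ∑ z : Fin n → A, f (fun t => g (z t)) * ∏ t, P (z t) =
      ∑ u : Fin n → B, f u * blockMass (fun b => ∑ a with g a = b, P a) u := by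
  classical
  rw [← Finset.sum_fiberwise (s := Finset.univ) (g := fun (z : Fin n → A) t => g (z t))]
  refine Finset.sum_congr rfl fun u _ => ?_
  rw [blockMass, Finset.prod_univ_sum, Finset.mul_sum]
  have : (Finset.univ.filter fun z : Fin n → A => (fun t => g (z t)) = u) =
      Fintype.piFinset fun t => Finset.univ.filter fun a => g a = u t := by
    ext z
    simp [Fintype.mem_piFinset, funext_iff]
  rw [← this]
  refine Finset.sum_congr rfl fun z hz => ?_
  rw [(Finset.mem_filter.1 hz).2]

lemma sum_toReal {A : Type*} [Fintype A] (p : PMF A) : ∑ a, (p a).toReal = 1 := by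
  rw [← ENNReal.toReal_sum fun a _ => p.apply_ne_top a, ← tsum_fintype (L := .unconditional _),
    p.tsum_coe, ENNReal.toReal_one]

lemma marginal_toReal {F : Type*} [Fintype F] [DecidableEq F] (P : PMF (Fin 2 → F)) (k : Fin 2)
    (b : F) : (marginal P k b).toReal = ∑ z with z k = b, (P z).toReal := by
  rw [marginal, PMF.map_apply, tsum_fintype,
    ENNReal.toReal_sum fun a _ => by split_ifs <;> simp [P.apply_ne_top], Finset.sum_filter]
  refine Finset.sum_congr rfl fun z _ => ?_
  by_cases h : z k = b
  · simp [h]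
  · simp [h, Ne.symm h]

/-! ### Large deviations -/

/-- Supplies the Chernoff exponent: a moment generating function with negative derivative at `0`
drops below its value `1` there for some positive `s`. -/
lemma exists_pos_lt_of_hasDerivAt_neg {g : ℝ → ℝ} {g' : ℝ} (hg : HasDerivAt g g' 0) (h : g' < 0) :
    ∃ s, 0 < s ∧ g s < g 0 := by
  have h1 : ∀ᶠ s in 𝓝[≠] (0 : ℝ), slope g 0 s < 0 :=
    (hasDerivAt_iff_tendsto_slope.1 hg).eventually_lt_const h
  have h2 : ∀ᶠ s in 𝓝[>] (0 : ℝ), slope g 0 s < 0 :=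
    h1.filter_mono (nhdsWithin_mono _ fun s (hs : 0 < s) => ne_of_gt hs)
  obtain ⟨s, hs, hs0⟩ := (h2.and self_mem_nhdsWithin).exists
  refine ⟨s, hs0, ?_⟩
  have hs0 : 0 < s := hs0
  rw [slope_def_field, sub_zero] at hs
  by_contra hc
  exact absurd hs (not_lt.2 (div_nonneg (by linarith) hs0.le))

/-- Chernoff's bound: if `X` has negative mean, then the probability that a sum of `n` independent
copies of `X` is nonnegative decays geometrically. -/
lemma exists_chernoff {A : Type*} [Fintype A] {p : A → ℝ} (hp : ∀ a, 0 ≤ p a)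
    (hp1 : ∑ a, p a = 1) {X : A → ℝ} (hX : ∑ a, p a * X a < 0) :
    ∃ ρ : ℝ, 0 ≤ ρ ∧ ρ < 1 ∧ ∀ (n : ℕ) (S : Finset (Fin n → A)),
      (∀ u ∈ S, blockMass p u ≠ 0 → 0 ≤ ∑ t, X (u t)) → ∑ u ∈ S, blockMass p u ≤ ρ ^ n := by
  classical
  set g : ℝ → ℝ := fun s => ∑ a, p a * Real.exp (s * X a) with hgdef
  have hg : HasDerivAt g (∑ a, p a * X a) 0 := by
    refine HasDerivAt.fun_sum fun a _ => HasDerivAt.const_mul (p a) ?_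
    have := ((hasDerivAt_id (0 : ℝ)).mul_const (X a)).exp
    simpa using this
  have hg0 : g 0 = 1 := by simp [hgdef, hp1]
  obtain ⟨s, hs, hgs⟩ := exists_pos_lt_of_hasDerivAt_neg hg hX
  refine ⟨g s, Finset.sum_nonneg fun a _ => mul_nonneg (hp a) (Real.exp_pos _).le, hg0 ▸ hgs,
    fun n S hS => ?_⟩
  -- Independence: the `n`-th power of the moment generating function is that of the sum, and its
  -- integrand dominates the mass wherever the sum is nonnegative.
  have hpow : g s ^ n = ∑ u : Fin n → A, blockMass p u * Real.exp (s * ∑ t, X (u t)) := by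
    have := Finset.prod_univ_sum (fun _ : Fin n => (Finset.univ : Finset A))
      (fun _ a => p a * Real.exp (s * X a))
    simp only [Finset.prod_const, Finset.card_univ, Fintype.card_fin, Fintype.piFinset_univ] at this
    rw [hgdef, this]
    refine Finset.sum_congr rfl fun u _ => ?_
    rw [Finset.prod_mul_distrib, Finset.mul_sum, Real.exp_sum, blockMass]
  rw [hpow]
  refine (Finset.sum_le_sum fun u hu => ?_).trans
    (Finset.sum_le_sum_of_subset_of_nonneg (Finset.subset_univ S) fun u _ _ =>
      mul_nonneg (blockMass_nonneg hp u) (Real.exp_pos _).le)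
  by_cases h0 : blockMass p u = 0
  · simp [h0]
  · exact le_mul_of_one_le_right (blockMass_nonneg hp u)
      (Real.one_le_exp (mul_nonneg hs.le (hS u hu h0)))

lemma logb_blockMass {A : Type*} {n : ℕ} {p : A → ℝ} {u : Fin n → A} (h : blockMass p u ≠ 0) :
    Real.logb 2 (blockMass p u) = ∑ t, Real.logb 2 (p (u t)) := by
  rw [blockMass, Real.logb_prod]
  exact fun t ht => Finset.prod_ne_zero_iff.1 h t ht

open Classical in
/-- For every `h > H(p)` there are sets of at most `2 ^ (n h)` blocks carrying almost all of the
probability. -/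
lemma exists_typicalSet {A : Type*} [Fintype A] (p : PMF A) {h : ℝ} (hh : entropy p < h) :
    ∃ ρ : ℝ, 0 ≤ ρ ∧ ρ < 1 ∧ ∀ n : ℕ, ∃ T : Finset (Fin n → A),
      (∑ u with u ∉ T, blockMass (fun a => (p a).toReal) u ≤ ρ ^ n) ∧
        (T.card : ℝ) ≤ 2 ^ ((n : ℝ) * h) := by
  set P : A → ℝ := fun a => (p a).toReal with hP
  have hP0 : ∀ a, 0 ≤ P a := fun a => ENNReal.toReal_nonneg
  have hP1 : ∑ a, P a = 1 := sum_toReal p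
  -- The variable `-log p - h` has mean `H(p) - h < 0`; its block sum is nonnegative exactly on
  -- atypically improbable blocks. Null blocks are exempt in `exists_chernoff`, because `logb 2 0 =
  -- 0` would spoil the sum.
  have hX : ∑ a, P a * (-Real.logb 2 (P a) - h) < 0 := by
    have : ∑ a, P a * (-Real.logb 2 (P a) - h) = entropy p - h := by
      simp only [mul_sub, Finset.sum_sub_distrib, ← Finset.sum_mul, hP, sum_toReal p, one_mul, entropy,
        mul_neg, Finset.sum_neg_distrib]
    linarith
  obtain ⟨ρ, hρ0, hρ1, hρ⟩ := exists_chernoff hP0 hP1 hX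
  refine ⟨ρ, hρ0, hρ1, fun n => ⟨Finset.univ.filter fun u => (2 : ℝ) ^ (-((n : ℝ) * h)) ≤
    blockMass P u, hρ n _ fun u hu h0 => ?_, ?_⟩⟩
  · simp only [Finset.mem_filter, Finset.mem_univ, true_and, not_le] at hu
    have hpos : 0 < blockMass P u := lt_of_le_of_ne (blockMass_nonneg hP0 u) (Ne.symm h0)
    have := (Real.logb_lt_iff_lt_rpow one_lt_two hpos).2 hu
    rw [logb_blockMass h0] at this
    simp only [Finset.sum_sub_distrib, Finset.sum_neg_distrib, Finset.sum_const, Finset.card_univ,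
      Fintype.card_fin, nsmul_eq_mul]
    linarith
  · set T := Finset.univ.filter fun u : Fin n → A => (2 : ℝ) ^ (-((n : ℝ) * h)) ≤ blockMass P u
    -- Every block of `T` has mass at least `2 ^ (-n h)`, and the total mass is `1`.
    have h1 : (T.card : ℝ) * (2 : ℝ) ^ (-((n : ℝ) * h)) ≤ 1 := by
      rw [← sum_blockMass hP1 n, ← nsmul_eq_mul, ← Finset.sum_const]
      exact (Finset.sum_le_sum fun u hu => (Finset.mem_filter.1 hu).2).trans
        (Finset.sum_le_sum_of_subset_of_nonneg (Finset.subset_univ T) fun u _ _ =>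
          blockMass_nonneg hP0 u)
    rwa [Real.rpow_neg zero_le_two, ← div_eq_mul_inv, div_le_one (by positivity)] at h1

/-- For every `h < H(p)` a set of blocks has probability at most `2 ^ (-n h)` times its size, up to
an error that decays geometrically. -/
lemma exists_sum_blockMass_le {A : Type*} [Fintype A] (p : PMF A) {h : ℝ} (hh : h < entropy p) :
    ∃ ρ : ℝ, 0 ≤ ρ ∧ ρ < 1 ∧ ∀ (n : ℕ) (D : Finset (Fin n → A)),
      ∑ u ∈ D, blockMass (fun a => (p a).toReal) u ≤ ρ ^ n + D.card * 2 ^ (-((n : ℝ) * h)) := by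
  classical
  set P : A → ℝ := fun a => (p a).toReal with hP
  have hP0 : ∀ a, 0 ≤ P a := fun a => ENNReal.toReal_nonneg
  have hP1 : ∑ a, P a = 1 := sum_toReal p
  have hX : ∑ a, P a * (Real.logb 2 (P a) + h) < 0 := by
    have : ∑ a, P a * (Real.logb 2 (P a) + h) = -entropy p + h := by
      simp only [mul_add, Finset.sum_add_distrib, ← Finset.sum_mul, hP, sum_toReal p, one_mul, entropy,
        neg_neg]
    linarith
  obtain ⟨ρ, hρ0, hρ1, hρ⟩ := exists_chernoff hP0 hP1 hX
  refine ⟨ρ, hρ0, hρ1, fun n D => ?_⟩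
  -- Blocks heavier than `2 ^ (-n h)` are jointly rare by Chernoff; the others are bounded by
  -- counting.
  rw [← Finset.sum_filter_add_sum_filter_not D
    fun u => (2 : ℝ) ^ (-((n : ℝ) * h)) ≤ blockMass P u]
  refine add_le_add (hρ n _ fun u hu h0 => ?_) ?_
  · have hpos : 0 < blockMass P u := lt_of_le_of_ne (blockMass_nonneg hP0 u) (Ne.symm h0)
    have := (Real.le_logb_iff_rpow_le one_lt_two hpos).2 (Finset.mem_filter.1 hu).2
    rw [logb_blockMass h0] at this
    simp only [Finset.sum_add_distrib, Finset.sum_const, Finset.card_univ,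
      Fintype.card_fin, nsmul_eq_mul]
    linarith
  · refine (Finset.sum_le_card_nsmul _ _ ((2 : ℝ) ^ (-((n : ℝ) * h))) fun u hu =>
      (not_le.1 (Finset.mem_filter.1 hu).2).le).trans ?_
    rw [nsmul_eq_mul]
    gcongr
    exact Finset.filter_subset _ _

lemma entropy_nonneg {A : Type*} [Fintype A] (p : PMF A) : 0 ≤ entropy p := by
  rw [entropy, ← Finset.sum_neg_distrib]
  refine Finset.sum_nonneg fun a _ => neg_nonneg.2 (mul_nonpos_of_nonneg_of_nonpos
    ENNReal.toReal_nonneg (Real.logb_nonpos one_lt_two ENNReal.toReal_nonneg ?_))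
  exact ENNReal.toReal_le_of_le_ofReal zero_le_one (by simpa using p.coe_le_one a)

/-! ### The converse -/

open Classical in
/-- The error probability at receiver `k` only depends on the law of the noise component `k`. -/
lemma errorProb_eq {F : Type*} [Field F] [Fintype F] {n : ℕ} (Q : Matrix (Fin 2) (Fin 2) F)
    (P : PMF (Fin 2 → F)) {W : Fin 2 → Type*} [∀ k, Fintype (W k)]
    (enc : (∀ k, W k) → Fin 2 → Fin n → F) (dec : ∀ k, (Fin n → F) → W k) (k : Fin 2) :
    errorProb Q P enc dec k =
      (∑ w, ∑ u : Fin n → F,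
        if dec k ((fun t => (Q *ᵥ fun j => enc w j t) k) + u) = w k then 0
        else blockMass (fun a => (marginal P k a).toReal) u) / Fintype.card (∀ k, W k) := by
  rw [errorProb]
  congr 1
  refine Finset.sum_congr rfl fun w _ => ?_
  have := sum_comp_mul_prod (n := n) (fun z : Fin 2 → F => z k) (fun z => (P z).toReal) fun u =>
    if dec k ((fun t => (Q *ᵥ fun j => enc w j t) k) + u) = w k then 0 else 1
  simp only [ite_mul, zero_mul, one_mul] at this
  rw [funext (marginal_toReal P k)]
  exact this

lemma errorProb_nonneg {F : Type*} [Field F] [Fintype F] {n : ℕ} (Q : Matrix (Fin 2) (Fin 2) F)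
    (P : PMF (Fin 2 → F)) {W : Fin 2 → Type*} [∀ k, Fintype (W k)]
    (enc : (∀ k, W k) → Fin 2 → Fin n → F) (dec : ∀ k, (Fin n → F) → W k) (k : Fin 2) :
    0 ≤ errorProb Q P enc dec k := by
  classical
  refine div_nonneg (Finset.sum_nonneg fun w _ => Finset.sum_nonneg fun z _ => ?_)
    (Nat.cast_nonneg _)
  split_ifs
  exacts [le_rfl, Finset.prod_nonneg fun _ _ => ENNReal.toReal_nonneg]

open Classical in
/-- The probability of correct decoding, written as a sum over correctly decoded noise blocks. -/
lemma one_sub_errorProb_eq {F : Type*} [Field F] [Fintype F] {n : ℕ}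
    (Q : Matrix (Fin 2) (Fin 2) F)
    (P : PMF (Fin 2 → F)) {W : Fin 2 → Type*} [∀ k, Fintype (W k)] [∀ k, Nonempty (W k)]
    (enc : (∀ k, W k) → Fin 2 → Fin n → F) (dec : ∀ k, (Fin n → F) → W k) (k : Fin 2) :
    1 - errorProb Q P enc dec k =
      (∑ w, ∑ u : Fin n → F with dec k ((fun t => (Q *ᵥ fun j => enc w j t) k) + u) = w k,
        blockMass (fun a => (marginal P k a).toReal) u) / Fintype.card (∀ k, W k) := by
  have hc : (Fintype.card (∀ k, W k) : ℝ) ≠ 0 := Nat.cast_ne_zero.2 Fintype.card_ne_zero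
  rw [errorProb_eq, eq_div_iff hc, sub_mul, one_mul, div_mul_cancel₀ _ hc, sub_eq_iff_eq_add,
    ← Finset.sum_add_distrib]
  have h1 := sum_blockMass (sum_toReal (marginal P k)) n
  rw [← Finset.card_univ, ← nsmul_one, ← Finset.sum_const]
  refine Finset.sum_congr rfl fun w _ => ?_
  rw [Finset.sum_filter, ← Finset.sum_add_distrib, ← h1]
  refine Finset.sum_congr rfl fun u _ => ?_
  split_ifs <;> simp

-- A coordinate of a uniform tuple is uniform; the product form avoids division.
open Classical in
lemma card_filter_apply_eq_mul {ι : Type*} [Fintype ι] {W : ι → Type*} [∀ k, Fintype (W k)]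
    (k : ι) (a : W k) :
    (Finset.univ.filter fun w : ∀ k, W k => w k = a).card * Fintype.card (W k) =
      Fintype.card (∀ k, W k) := by
  have := Fintype.card_filter_piFinset_eq_of_mem (fun k => (Finset.univ : Finset (W k))) k
    (Finset.mem_univ a)
  rw [Fintype.piFinset_univ] at this
  rw [this, Fintype.card_pi]
  exact Finset.prod_erase_mul _ _ (Finset.mem_univ k)

/-- Packing bound: a receiver of a code with `M` messages decodes correctly with probability
at most `q ^ n 2 ^ (-n h) / M`, up to a geometrically decaying error, for every `h < H(ζ_k)`. -/
lemma exists_one_sub_errorProb_le {F : Type*} [Field F] [Fintype F] (Q : Matrix (Fin 2) (Fin 2) F)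
    (P : PMF (Fin 2 → F)) (k : Fin 2) {h : ℝ} (hh : h < entropy (marginal P k)) :
    ∃ ρ : ℝ, 0 ≤ ρ ∧ ρ < 1 ∧ ∀ (n : ℕ) (W : Fin 2 → Type) [∀ k, Fintype (W k)]
      [∀ k, Nonempty (W k)] (enc : (∀ k, W k) → Fin 2 → Fin n → F) (dec : ∀ k, (Fin n → F) → W k),
      1 - errorProb Q P enc dec k ≤ ρ ^ n +
        (Fintype.card F : ℝ) ^ n * 2 ^ (-((n : ℝ) * h)) / Fintype.card (W k) := by
  classical
  obtain ⟨ρ, hρ0, hρ1, hρ⟩ := exists_sum_blockMass_le _ hh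
  refine ⟨ρ, hρ0, hρ1, fun n W _ _ enc dec => ?_⟩
  have hc : (0 : ℝ) < Fintype.card (∀ k, W k) := Nat.cast_pos.2 Fintype.card_pos
  have hk : (0 : ℝ) < Fintype.card (W k) := Nat.cast_pos.2 Fintype.card_pos
  set x : (∀ k, W k) → Fin n → F := fun w t => (Q *ᵥ fun j => enc w j t) k with hx
  -- Translating by the noiseless signal turns the correctly decoded noise blocks into the decoding
  -- region of `w k`.
  have hcard : ∀ w : ∀ k, W k, (Finset.univ.filter fun u => dec k (x w + u) = w k).card =
      (Finset.univ.filter fun y => dec k y = w k).card := fun w =>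
    Finset.card_equiv (Equiv.addLeft (x w)) fun u => by simp
  have hsum : (∑ w : ∀ k, W k, ((Finset.univ.filter fun y => dec k y = w k).card : ℝ)) *
      Fintype.card (W k) = (Fintype.card F : ℝ) ^ n * Fintype.card (∀ k, W k) := by
    -- Double counting of pairs `(w, y)` with `dec k y = w k`.
    have : ∑ w : ∀ k, W k, (Finset.univ.filter fun y => dec k y = w k).card =
        ∑ y : Fin n → F, (Finset.univ.filter fun w : ∀ k, W k => w k = dec k y).card := by
      simp only [Finset.card_filter]
      rw [Finset.sum_comm]
      simp only [eq_comm]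
    have h2 : (∑ w : ∀ k, W k, (Finset.univ.filter fun y => dec k y = w k).card) *
      Fintype.card (W k) = (Fintype.card F) ^ n * Fintype.card (∀ k, W k) := by
      rw [this, Finset.sum_mul, Finset.sum_congr rfl fun y _ => ?_, Finset.sum_const,
        Finset.card_univ, Fintype.card_fun, Fintype.card_fin, smul_eq_mul]
      convert card_filter_apply_eq_mul k (dec k y)
    exact_mod_cast h2
  rw [one_sub_errorProb_eq, div_le_iff₀ hc]
  calc _ ≤ ∑ w : ∀ k, W k, (ρ ^ n +
        ((Finset.univ.filter fun y => dec k y = w k).card : ℝ) * 2 ^ (-((n : ℝ) * h))) := by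
        refine Finset.sum_le_sum fun w _ => ?_
        rw [← hcard w]
        exact hρ n _
    _ = ρ ^ n * Fintype.card (∀ k, W k) + ((∑ w : ∀ k, W k,
          ((Finset.univ.filter fun y => dec k y = w k).card : ℝ)) * Fintype.card (W k)) *
            2 ^ (-((n : ℝ) * h)) / Fintype.card (W k) := by
        rw [Finset.sum_add_distrib, ← Finset.sum_mul, Finset.sum_const, Finset.card_univ,
          nsmul_eq_mul, mul_right_comm, mul_div_cancel_right₀ _ hk.ne', mul_comm (ρ ^ n)]
    _ = _ := by
        rw [hsum]
        ring

/-- The rates achievable over the broadcast channel are bounded by the single-user capacities. -/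
lemma BCAchievable.le {F : Type*} [Field F] [Fintype F] {Q : Matrix (Fin 2) (Fin 2) F}
    {P : PMF (Fin 2 → F)} {R : Fin 2 → ℝ} (hR : BCAchievable Q P R) (k : Fin 2) :
    R k ≤ Real.logb 2 (Fintype.card F) - entropy (marginal P k) := by
  obtain ⟨-, M, c, hM, hc⟩ := hR
  by_contra! hlt
  obtain ⟨h, h1, h2⟩ := exists_between (show Real.logb 2 (Fintype.card F) - R k <
    entropy (marginal P k) by linarith)
  obtain ⟨ρ, hρ0, hρ1, hρ⟩ := exists_one_sub_errorProb_le Q P k h2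
  set β : ℝ := 2 ^ (Real.logb 2 (Fintype.card F) - h - R k) with hβ
  have hβ0 : 0 ≤ β := Real.rpow_nonneg zero_le_two _
  have hβ1 : β < 1 := Real.rpow_lt_one_of_one_lt_of_neg one_lt_two (by linarith)
  have hq : (0 : ℝ) < Fintype.card F := Nat.cast_pos.2 Fintype.card_pos
  have hMpos : ∀ n k, (0 : ℝ) < M n k := fun n k =>
    (Real.rpow_pos_of_pos zero_lt_two _).trans_le (hM n k)
  have hb : ∀ n, 1 - errorProb Q P (c n).enc (c n).dec k ≤ ρ ^ n + β ^ n := fun n => by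
    have : ∀ k, Nonempty (Fin (M n k)) := fun k =>
      Fin.pos_iff_nonempty.1 (Nat.cast_pos.1 (hMpos n k))
    refine (hρ n (fun k => Fin (M n k)) (c n).enc (c n).dec).trans ?_
    gcongr
    rw [Fintype.card_fin, div_le_iff₀ (hMpos n k)]
    refine le_trans (le_of_eq ?_) (mul_le_mul_of_nonneg_left (hM n k) (pow_nonneg hβ0 n))
    rw [hβ, ← Real.rpow_mul_natCast zero_le_two, ← Real.rpow_add zero_lt_two]
    nth_rewrite 1 [← Real.rpow_logb zero_lt_two (by norm_num) hq]
    rw [← Real.rpow_mul_natCast zero_le_two, ← Real.rpow_add zero_lt_two]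
    ring_nf
  -- In the limit the success probability `1` would be at most `0`.
  have hlim := le_of_tendsto_of_tendsto' ((hc k).const_sub 1)
    ((tendsto_pow_atTop_nhds_zero_of_lt_one hρ0 hρ1).add
      (tendsto_pow_atTop_nhds_zero_of_lt_one hβ0 hβ1)) hb
  norm_num at hlim

/-- A code for the cognitive interference channel is a code for the broadcast channel. -/
lemma AchievableBy.bcAchievable {F : Type*} [Field F] [Fintype F] {Q : Matrix (Fin 2) (Fin 2) F}
    {P : PMF (Fin 2 → F)} {S : ∀ {n : ℕ} {r : Fin 2 → ℕ}, Code F n r → Prop} {R : Fin 2 → ℝ}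
    (hR : AchievableBy Q P S R) : BCAchievable Q P R := by
  classical
  obtain ⟨h0, r, c, -, hr, hc⟩ := hR
  let e : ∀ n k, (Fin (r n k) → F) ≃ Fin (Fintype.card (Fin (r n k) → F)) := fun n k =>
    Fintype.equivFin _
  refine ⟨h0, fun n k => Fintype.card (Fin (r n k) → F), fun n =>
    ⟨fun w => (c n).encode fun k => (e n k).symm (w k), fun k y => e n k ((c n).dec k y)⟩,
    fun n k => ?_, fun k => (hc k).congr fun n => ?_⟩
  · have hq : (0 : ℝ) < Fintype.card F := Nat.cast_pos.2 Fintype.card_pos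
    simp only [Fintype.card_fun, Fintype.card_fin, Nat.cast_pow]
    nth_rewrite 1 [← Real.rpow_logb zero_lt_two (by norm_num) hq]
    rw [← Real.rpow_mul_natCast zero_le_two]
    exact Real.rpow_le_rpow_of_exponent_le one_le_two (by linarith [hr n k])
  · rw [errorProb, errorProb]
    congr 1
    · refine Fintype.sum_equiv (Equiv.piCongrRight (e n)) _ _ fun w => ?_
      simp only [Equiv.piCongrRight, Equiv.coe_fn_mk, Pi.map_apply, Equiv.symm_apply_apply,
        EmbeddingLike.apply_eq_iff_eq]
      congr!
    · exact_mod_cast Fintype.card_congr (Equiv.piCongrRight (e n))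

/-! ### Random linear codes -/

lemma zeroPad_sub {F : Type*} [Field F] {m : ℕ} (r : ℕ) (v w : Fin m → F) :
    zeroPad r (v - w) = zeroPad r v - zeroPad r w := by
  funext i
  simp only [zeroPad, Pi.sub_apply]
  split_ifs <;> simp

lemma zeroPad_ne_zero {F : Type*} [Field F] {m r : ℕ} (h : m ≤ r) {w : Fin m → F} (hw : w ≠ 0) :
    zeroPad r w ≠ 0 := by
  obtain ⟨i, hi⟩ := Function.ne_iff.1 hw
  refine Function.ne_iff.2 ⟨Fin.castLE h i, ?_⟩
  simpa [zeroPad] using hi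

/-- Where `x i ≠ 0`, the rank-one matrix whose only nonzero row is `(x i)⁻¹ • y`, at index `i`, is a
preimage of `y`. -/
lemma surjective_vecMul {F : Type*} [Field F] {ι κ : Type*} [Fintype ι] {x : ι → F}
    (hx : x ≠ 0) : Function.Surjective fun G : Matrix ι κ F => x ᵥ* G := by
  classical
  obtain ⟨i, hi⟩ := Function.ne_iff.1 hx
  refine fun y => ⟨vecMulVec (Pi.single i (x i)⁻¹) y, ?_⟩
  have hi : x i ≠ 0 := hi
  simp [vecMul_vecMulVec, hi]

open Classical in
/-- For a nonzero `x` and a uniformly random matrix `G`, the vector `x G` is uniform. -/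
lemma card_filter_vecMul_mul {F : Type*} [Field F] [Fintype F] {N n : ℕ} {x : Fin N → F}
    (hx : x ≠ 0) (u : Fin n → F) (T : Finset (Fin n → F)) :
    (Finset.univ.filter fun G : Matrix (Fin N) (Fin n) F => u + x ᵥ* G ∈ T).card *
      Fintype.card F ^ n = T.card * Fintype.card (Matrix (Fin N) (Fin n) F) := by
  let f : Matrix (Fin N) (Fin n) F →+ (Fin n → F) :=
    { toFun := fun G => x ᵥ* G, map_zero' := vecMul_zero x, map_add' := fun A B => vecMul_add A B x}
  have hf : ∀ y, y ∈ Set.range f := surjective_vecMul hx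
  set c := (Finset.univ.filter fun G => f G = 0).card with hc
  -- All fibres are cosets of the kernel, hence of equal size.
  have hfib : ∀ y, (Finset.univ.filter fun G => f G = y).card = c := fun y =>
    AddMonoidHom.card_fiber_eq_of_mem_range f (hf y) (hf 0)
  have h1 : Fintype.card (Matrix (Fin N) (Fin n) F) = Fintype.card F ^ n * c := by
    rw [← Finset.card_univ, Finset.card_eq_sum_card_fiberwise (f := f) (t := Finset.univ)
      (fun _ _ => Finset.mem_coe.2 (Finset.mem_univ _))]
    simp [hfib]
  have h2 : (Finset.univ.filter fun G : Matrix (Fin N) (Fin n) F => u + x ᵥ* G ∈ T).card =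
      T.card * c := by
    rw [Finset.card_eq_sum_card_fiberwise (f := fun G : Matrix (Fin N) (Fin n) F => u + x ᵥ* G)
      (s := Finset.univ.filter fun G => u + x ᵥ* G ∈ T) (t := T)
      (fun G hG => (Finset.mem_filter.1 hG).2), Finset.sum_congr rfl fun y hy => ?_,
      Finset.sum_const, smul_eq_mul]
    rw [← hfib (y - u)]
    congr 1
    ext G
    simp only [Finset.mem_filter, Finset.mem_univ, true_and, eq_sub_iff_add_eq, add_comm u]
    exact ⟨fun h => h.2, fun h => ⟨h.symm ▸ hy, h⟩⟩
  rw [h1, h2]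
  ring

open Classical in
/-- The expected probability of a given codeword difference for a random generator matrix. -/
lemma sum_sum_blockMass_vecMul {F : Type*} [Field F] [Fintype F] {N n : ℕ} {p : F → ℝ}
    (hp : ∑ a, p a = 1) {x : Fin N → F} (hx : x ≠ 0) (T : Finset (Fin n → F)) :
    ∑ G : Matrix (Fin N) (Fin n) F, ∑ u with u + x ᵥ* G ∈ T, blockMass p u =
      T.card / (Fintype.card F : ℝ) ^ n * Fintype.card (Matrix (Fin N) (Fin n) F) := by
  have hq : (Fintype.card F : ℝ) ^ n ≠ 0 := pow_ne_zero _ (Nat.cast_ne_zero.2 Fintype.card_ne_zero)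
  simp only [Finset.sum_filter]
  rw [Finset.sum_comm]
  have : ∀ u : Fin n → F, ∑ G : Matrix (Fin N) (Fin n) F,
      (if u + x ᵥ* G ∈ T then blockMass p u else 0) = blockMass p u *
        (T.card / (Fintype.card F : ℝ) ^ n * Fintype.card (Matrix (Fin N) (Fin n) F)) := by
    intro u
    rw [← Finset.sum_filter, Finset.sum_const, nsmul_eq_mul, mul_comm]
    congr 1
    rw [div_mul_eq_mul_div, eq_div_iff hq]
    exact_mod_cast card_filter_vecMul_mul hx u T
  rw [Finset.sum_congr rfl fun u _ => this u, ← Finset.sum_mul, sum_blockMass hp, one_mul]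

-- Union bound over the nonzero `x` with `x G = 0`: each occurs with probability `q ^ (-n)`.
open Classical in
lemma card_not_linearIndependent_le {F : Type*} [Field F] [Fintype F] (N n : ℕ) :
    ((Finset.univ.filter fun G : Matrix (Fin N) (Fin n) F =>
      ¬ LinearIndependent F G.row).card : ℝ) ≤ (Fintype.card F : ℝ) ^ N /
        (Fintype.card F : ℝ) ^ n * Fintype.card (Matrix (Fin N) (Fin n) F) := by
  have hq : (0 : ℝ) < (Fintype.card F : ℝ) ^ n := pow_pos (Nat.cast_pos.2 Fintype.card_pos) _
  have hsub : (Finset.univ.filter fun G : Matrix (Fin N) (Fin n) F => ¬ LinearIndependent F G.row) ⊆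
      (Finset.univ.filter fun x : Fin N → F => x ≠ 0).biUnion fun x =>
        Finset.univ.filter fun G : Matrix (Fin N) (Fin n) F => 0 + x ᵥ* G ∈ ({0} : Finset _) := by
    intro G hG
    have hG := (Finset.mem_filter.1 hG).2
    rw [← vecMul_injective_iff] at hG
    have : ∃ x : Fin N → F, x ᵥ* G = 0 ∧ x ≠ 0 := by
      by_contra! h
      exact hG fun v w hvw => sub_eq_zero.1 (h _ (by
        rw [sub_vecMul]
        exact sub_eq_zero.2 hvw))
    obtain ⟨x, hx, hx0⟩ := this
    exact Finset.mem_biUnion.2 ⟨x, by simpa using hx0, by simpa using hx⟩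
  rw [div_mul_eq_mul_div, le_div_iff₀ hq]
  have : (Finset.univ.filter fun G : Matrix (Fin N) (Fin n) F =>
      ¬ LinearIndependent F G.row).card * Fintype.card F ^ n ≤
        Fintype.card F ^ N * Fintype.card (Matrix (Fin N) (Fin n) F) := by
    refine (Nat.mul_le_mul_right _ ((Finset.card_le_card hsub).trans
      Finset.card_biUnion_le)).trans ?_
    rw [Finset.sum_mul]
    refine (Finset.sum_le_card_nsmul _ _ (Fintype.card (Matrix (Fin N) (Fin n) F))
      fun x hx => ?_).trans ?_
    · rw [card_filter_vecMul_mul (Finset.mem_filter.1 hx).2]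
      simp
    · rw [smul_eq_mul]
      refine Nat.mul_le_mul_right _ ((Finset.card_filter_le _ _).trans ?_)
      simp
  exact_mod_cast this

open Classical in
/-- Upper bound for the error probability of set decoding with generator matrix `G`, scaling `l`
and decoding set `T`. -/
noncomputable def unionBound {F : Type*} [Field F] [Fintype F] {N n : ℕ} (p : F → ℝ) (m : ℕ) (l : F)
    (T : Finset (Fin n → F)) (G : Matrix (Fin N) (Fin n) F) : ℝ :=
  ∑ u with u ∉ T, blockMass p u +
    ∑ v : Fin m → F with v ≠ 0, ∑ u with u + (l • zeroPad N v) ᵥ* G ∈ T, blockMass p u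

lemma unionBound_nonneg {F : Type*} [Field F] [Fintype F] {N n : ℕ} {p : F → ℝ}
    (hp : ∀ a, 0 ≤ p a) (m : ℕ) (l : F) (T : Finset (Fin n → F)) (G : Matrix (Fin N) (Fin n) F) :
    0 ≤ unionBound p m l T G := by
  classical
  exact add_nonneg (Finset.sum_nonneg fun u _ => blockMass_nonneg hp u)
    (Finset.sum_nonneg fun v _ => Finset.sum_nonneg fun u _ => blockMass_nonneg hp u)

open Classical in
/-- The average of `unionBound` over all generator matrices. -/
noncomputable def meanBound {F : Type*} [Fintype F] {n : ℕ} (p : F → ℝ) (m : ℕ)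
    (T : Finset (Fin n → F)) : ℝ :=
  ∑ u with u ∉ T, blockMass p u +
    ((Fintype.card F : ℝ) ^ m - 1) * (T.card / (Fintype.card F : ℝ) ^ n)

lemma sum_unionBound {F : Type*} [Field F] [Fintype F] {N n m : ℕ} (hm : m ≤ N) {p : F → ℝ}
    (hp : ∑ a, p a = 1) {l : F} (hl : l ≠ 0) (T : Finset (Fin n → F)) :
    ∑ G : Matrix (Fin N) (Fin n) F, unionBound p m l T G =
      meanBound p m T * Fintype.card (Matrix (Fin N) (Fin n) F) := by
  classical
  simp only [unionBound, meanBound]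
  rw [Finset.sum_add_distrib, Finset.sum_const, Finset.card_univ, nsmul_eq_mul, Finset.sum_comm,
    Finset.sum_congr rfl fun v hv => sum_sum_blockMass_vecMul hp
      (smul_ne_zero hl (zeroPad_ne_zero hm (Finset.mem_filter.1 hv).2)) T,
    Finset.sum_const, nsmul_eq_mul]
  have : ((Finset.univ.filter fun v : Fin m → F => v ≠ 0).card : ℝ) =
      (Fintype.card F : ℝ) ^ m - 1 := by
    have h := Finset.card_erase_add_one (Finset.mem_univ (0 : Fin m → F))
    rw [← Finset.filter_ne', Finset.card_univ, Fintype.card_fun, Fintype.card_fin] at h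
    rw [eq_sub_iff_add_eq]
    exact_mod_cast h
  rw [this]
  ring

/-- If the average union bounds and the probability of rank deficiency are small, then some
generator matrix of full rank is simultaneously good for both receivers. -/
lemma exists_generator {F : Type*} [Field F] [Fintype F] {n : ℕ} (r : Fin 2 → ℕ)
    (p : Fin 2 → F → ℝ) (hp0 : ∀ k a, 0 ≤ p k a) (hp : ∀ k, ∑ a, p k a = 1) {l : Fin 2 → F}
    (hl : ∀ k, l k ≠ 0) (T : Fin 2 → Finset (Fin n → F)) {b : ℝ} (hb1 : b < 1)
    (hb : ∑ k, (meanBound (p k) (r k) (T k) +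
      (Fintype.card F : ℝ) ^ r k / (Fintype.card F : ℝ) ^ n) ≤ b) :
    ∃ G : Matrix (Fin (max (r 0) (r 1))) (Fin n) F, LinearIndependent F G.row ∧
      ∀ k, unionBound (p k) (r k) (l k) (T k) G ≤ b := by
  classical
  set N := max (r 0) (r 1) with hN
  have hr : ∀ k, r k ≤ N := Fin.forall_fin_two.2 ⟨le_max_left _ _, le_max_right _ _⟩
  have hq : (0 : ℝ) < (Fintype.card F : ℝ) ^ n := pow_pos (Nat.cast_pos.2 Fintype.card_pos) _
  have hpow : (Fintype.card F : ℝ) ^ N ≤ ∑ k, (Fintype.card F : ℝ) ^ r k := by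
    have h : ∀ k, (0 : ℝ) ≤ (Fintype.card F : ℝ) ^ r k := fun k => by positivity
    rw [Fin.sum_univ_two]
    rcases max_choice (r 0) (r 1) with h' | h' <;> rw [hN, h'] <;> linarith [h 0, h 1]
  -- The indicator enters with weight `1`, so a matrix meeting the average `b < 1` must have full
  -- rank.
  have havg : ∑ G : Matrix (Fin N) (Fin n) F, (∑ k, unionBound (p k) (r k) (l k) (T k) G +
      if ¬ LinearIndependent F G.row then 1 else 0) ≤ ∑ _G : Matrix (Fin N) (Fin n) F, b := by
    rw [Finset.sum_add_distrib, Finset.sum_comm,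
      Finset.sum_congr rfl fun k _ => sum_unionBound (hr k) (hp k) (hl k) (T k),
      Finset.sum_boole, Finset.sum_const, Finset.card_univ, nsmul_eq_mul, mul_comm _ b,
      ← Finset.sum_mul]
    refine (add_le_add_right (card_not_linearIndependent_le N n) _).trans ?_
    rw [← add_mul]
    refine mul_le_mul_of_nonneg_right (le_trans ?_ hb) (Nat.cast_nonneg _)
    rw [Finset.sum_add_distrib, ← Finset.sum_div]
    gcongr
  obtain ⟨G, -, hG⟩ := Finset.exists_le_of_sum_le Finset.univ_nonempty havg
  have hnn : ∀ k, 0 ≤ unionBound (p k) (r k) (l k) (T k) G := fun k =>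
    unionBound_nonneg (hp0 k) _ _ _ _
  refine ⟨G, ?_, fun k => ?_⟩
  · by_contra hG'
    rw [if_pos hG'] at hG
    linarith [Finset.sum_nonneg fun k (_ : k ∈ Finset.univ) => hnn k]
  · refine le_trans (Finset.single_le_sum (fun k _ => hnn k) (Finset.mem_univ k)) (le_trans ?_ hG)
    refine le_add_of_nonneg_right ?_
    split_ifs <;> simp

/-! ### Distributed zero-forcing -/

/-- The coefficient of the desired codeword at each receiver. -/
def desiredCoeff {F : Type*} [Field F] (Q : Matrix (Fin 2) (Fin 2) F) (m : Fin 3 → F) :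
    Fin 2 → F :=
  ![Q 0 0 * m 0 + Q 0 1 * m 2, Q 1 0 * m 1 + Q 1 1 * m 2]

lemma IsZeroForcing.desiredCoeff_ne_zero {F : Type*} [Field F] {Q : Matrix (Fin 2) (Fin 2) F}
    {m : Fin 3 → F} (h : IsZeroForcing Q m) (k : Fin 2) : desiredCoeff Q m k ≠ 0 := by
  revert k
  exact Fin.forall_fin_two.2 ⟨h.2.2.1, h.2.2.2⟩

/-- With `m_3 = 1` the cancellation equations determine `m_1` and `m_2`; the desired coefficients
become `-det Q / q_21` and `det Q / q_11`. -/
lemma exists_isZeroForcing {F : Type*} [Field F] {Q : Matrix (Fin 2) (Fin 2) F}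
    (hQ : Q.det ≠ 0) (h11 : Q 0 0 ≠ 0) (h21 : Q 1 0 ≠ 0) : ∃ m, IsZeroForcing Q m := by
  rw [det_fin_two] at hQ
  refine ⟨![-Q 1 1 / Q 1 0, -Q 0 1 / Q 0 0, 1], ?_, ?_, ?_, ?_⟩
  · simp [mul_div_cancel₀, h11]
  · simp [mul_div_cancel₀, h21]
  · intro h
    simp only [cons_val] at h
    field_simp at h
    exact hQ (by linear_combination -h)
  · intro h
    simp only [cons_val] at h
    field_simp at h
    exact hQ (by linear_combination h)

open Classical in
/-- The precoded linear code with generator matrix `G`; receiver `k` looks for a message whose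
codeword differs from the received block by an element of `T k`. -/
noncomputable def precodedCode {F : Type*} [Field F] (Q : Matrix (Fin 2) (Fin 2) F)
    (m : Fin 3 → F) {n : ℕ} {r : Fin 2 → ℕ} (T : Fin 2 → Finset (Fin n → F))
    (G : Matrix (Fin (max (r 0) (r 1))) (Fin n) F) : Code F n r where
  enc₁ w := m 0 • (padded w 0 ᵥ* G) + m 1 • (padded w 1 ᵥ* G)
  enc₂ v := m 2 • (v ᵥ* G)
  dec k y := if h : ∃ w : Fin (r k) → F,
    y - desiredCoeff Q m k • (zeroPad (max (r 0) (r 1)) w ᵥ* G) ∈ T k then h.choose else 0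

lemma mulVec_precodedCode {F : Type*} [Field F] {Q : Matrix (Fin 2) (Fin 2) F}
    {m : Fin 3 → F} (h : IsZeroForcing Q m) {n : ℕ} {r : Fin 2 → ℕ}
    (T : Fin 2 → Finset (Fin n → F)) (G : Matrix (Fin (max (r 0) (r 1))) (Fin n) F)
    (w : ∀ k, Fin (r k) → F) (k : Fin 2) :
    (fun t => (Q *ᵥ fun j => (precodedCode Q m T G).encode w j t) k) =
      desiredCoeff Q m k • (padded w k ᵥ* G) := by
  funext t
  obtain ⟨h1, h2, -, -⟩ := h
  revert k
  refine Fin.forall_fin_two.2 ⟨?_, ?_⟩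
  · simp only [mulVec, dotProduct, Fin.sum_univ_two, Code.encode, precodedCode, desiredCoeff,
      cons_val_zero, cons_val_one, Pi.add_apply, Pi.smul_apply, smul_eq_mul, add_vecMul]
    linear_combination (padded w 1 ᵥ* G) t * h1
  · simp only [mulVec, dotProduct, Fin.sum_univ_two, Code.encode, precodedCode, desiredCoeff,
      cons_val_zero, cons_val_one, Pi.add_apply, Pi.smul_apply, smul_eq_mul, add_vecMul]
    linear_combination (padded w 0 ᵥ* G) t * h2

/-- An error requires that the noise leave `T k`, or that some wrong message also pass the test; the
latter depends only on the message difference, by linearity. -/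
lemma errorProb_precodedCode_le {F : Type*} [Field F] [Fintype F] {Q : Matrix (Fin 2) (Fin 2) F}
    (P : PMF (Fin 2 → F)) {m : Fin 3 → F} (h : IsZeroForcing Q m) {n : ℕ} {r : Fin 2 → ℕ}
    (T : Fin 2 → Finset (Fin n → F)) (G : Matrix (Fin (max (r 0) (r 1))) (Fin n) F) (k : Fin 2) :
    errorProb Q P (precodedCode Q m T G).encode (precodedCode Q m T G).dec k ≤
      unionBound (fun a => (marginal P k a).toReal) (r k) (desiredCoeff Q m k) (T k) G := by
  classical
  have hp : ∀ a, 0 ≤ (marginal P k a).toReal := fun a => ENNReal.toReal_nonneg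
  rw [errorProb_eq, div_le_iff₀ (Nat.cast_pos.2 Fintype.card_pos), mul_comm, ← nsmul_eq_mul,
    ← Finset.card_univ]
  refine Finset.sum_le_card_nsmul _ _ _ fun w _ => ?_
  rw [mulVec_precodedCode h, unionBound]
  simp only [Finset.sum_filter (p := fun u => _ ∈ T k), Finset.sum_filter (p := fun u => u ∉ T k)]
  rw [Finset.sum_comm, ← Finset.sum_add_distrib]
  refine Finset.sum_le_sum fun u _ => ?_
  have hu := blockMass_nonneg hp u
  have hs : ∀ v ∈ Finset.univ.filter fun v : Fin (r k) → F => v ≠ 0,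
      0 ≤ if u + (desiredCoeff Q m k • zeroPad (max (r 0) (r 1)) v) ᵥ* G ∈ T k then
        blockMass (fun a => (marginal P k a).toReal) u else 0 := fun v _ => by
    split_ifs
    exacts [hu, le_rfl]
  split_ifs with hd hT hT
  · exact add_nonneg le_rfl (Finset.sum_nonneg hs)
  · exact add_nonneg hu (Finset.sum_nonneg hs)
  · rw [zero_add]
    have hex : ∃ w' : Fin (r k) → F, desiredCoeff Q m k • (padded w k ᵥ* G) + u -
        desiredCoeff Q m k • (zeroPad (max (r 0) (r 1)) w' ᵥ* G) ∈ T k :=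
      ⟨w k, by simpa [padded] using hT⟩
    simp only [precodedCode, dif_pos hex] at hd
    -- The relevant term of the union is the difference between the sent and the chosen message.
    refine le_trans (le_of_eq ?_) (Finset.single_le_sum hs (Finset.mem_filter.2
      ⟨Finset.mem_univ (w k - hex.choose), sub_ne_zero.2 (Ne.symm hd)⟩))
    rw [if_pos]
    convert hex.choose_spec using 1
    generalize hex.choose = w'
    rw [zeroPad_sub, smul_vecMul, sub_vecMul, smul_sub,
      show padded w k = zeroPad _ (w k) from rfl]
    abel
  · exact le_add_of_nonneg_right (Finset.sum_nonneg hs)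

lemma isPrecodedLinear_precodedCode {F : Type*} [Field F] (Q : Matrix (Fin 2) (Fin 2) F)
    (m : Fin 3 → F) {n : ℕ} {r : Fin 2 → ℕ} (T : Fin 2 → Finset (Fin n → F))
    {G : Matrix (Fin (max (r 0) (r 1))) (Fin n) F} (hG : LinearIndependent F G.row) :
    IsPrecodedLinear m (precodedCode Q m T G) :=
  ⟨G, hG, fun _ => rfl, fun _ => rfl⟩

/-- Serves the block lengths at which the random-coding bound is vacuous: a full-rank code is still
required there. -/
lemma exists_linearIndependent_row (F : Type*) [Field F] {N n : ℕ} (h : N ≤ n) :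
    ∃ G : Matrix (Fin N) (Fin n) F, LinearIndependent F G.row :=
  ⟨fun i => Pi.basisFun F (Fin n) (Fin.castLE h i),
    (Pi.basisFun F (Fin n)).linearIndependent.comp _ (Fin.castLE_injective h)⟩

/-- Below capacity there are message lengths and decoding sets whose average union bound tends
to zero. -/
lemma exists_meanBound_tendsto {F : Type*} [Field F] [Fintype F] (p : PMF F) {R : ℝ} (hR : 0 ≤ R)
    (h : R = 0 ∨ R < Real.logb 2 (Fintype.card F) - entropy p) :
    ∃ (r : ℕ → ℕ) (T : ∀ n, Finset (Fin n → F)),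
      (∀ n : ℕ, (n : ℝ) * R ≤ r n * Real.logb 2 (Fintype.card F)) ∧ (∀ n, r n ≤ n) ∧
      Tendsto (fun n => meanBound (fun a => (p a).toReal) (r n) (T n) +
        (Fintype.card F : ℝ) ^ r n / (Fintype.card F : ℝ) ^ n) atTop (𝓝 0) := by
  classical
  have hq1 : (1 : ℝ) < Fintype.card F := Nat.one_lt_cast.2 Fintype.one_lt_card
  have hq0 : (0 : ℝ) < Fintype.card F := zero_lt_one.trans hq1
  rcases h with rfl | h
  -- Zero rate is possible even at zero capacity: with a single message and `T` everything, only the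
  -- rank term `q ^ (-n)` survives.
  · refine ⟨fun _ => 0, fun n => Finset.univ, fun n => by simp, fun n => Nat.zero_le n, ?_⟩
    have := tendsto_pow_atTop_nhds_zero_of_lt_one (inv_nonneg.2 hq0.le) (inv_lt_one_of_one_lt₀ hq1)
    simpa [meanBound] using this
  set L := Real.logb 2 (Fintype.card F) with hL
  have hLpos : 0 < L := Real.logb_pos one_lt_two hq1
  have hqL : ∀ x : ℝ, (Fintype.card F : ℝ) ^ x = 2 ^ (L * x) := fun x => by
    rw [Real.rpow_mul zero_le_two, hL, Real.rpow_logb zero_lt_two (by norm_num) hq0]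
  have hqn : ∀ n : ℕ, (Fintype.card F : ℝ) ^ n = 2 ^ (L * n) := fun n => by
    rw [← hqL, Real.rpow_natCast]
  obtain ⟨H, h1, h2⟩ := exists_between (show entropy p < L - R by linarith)
  have hH : 0 < H := (entropy_nonneg p).trans_lt h1
  obtain ⟨ρ, hρ0, hρ1, hT⟩ := exists_typicalSet p h1
  choose T hT1 hT2 using hT
  set r : ℕ → ℕ := fun n => ⌈n * R / L⌉₊ with hr
  -- Rounding the message length up costs at most a factor `q`.
  have hrq : ∀ n, (Fintype.card F : ℝ) ^ r n ≤ Fintype.card F * 2 ^ ((n : ℝ) * R) := fun n => by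
    have hceil : (r n : ℝ) ≤ n * R / L + 1 := (Nat.ceil_lt_add_one (by positivity)).le
    rw [← Real.rpow_natCast]
    refine (Real.rpow_le_rpow_of_exponent_le hq1.le hceil).trans ?_
    rw [Real.rpow_add hq0, Real.rpow_one, mul_comm, hqL, mul_div_cancel₀ _ hLpos.ne']
  -- `2 ^ (n R)` messages times `2 ^ (n H)` typical blocks, relative to `q ^ n = 2 ^ (n L)` blocks.
  set β : ℝ := 2 ^ (R + H - L) with hβ
  have hβ0 : 0 ≤ β := Real.rpow_nonneg zero_le_two _
  have hβ1 : β < 1 := Real.rpow_lt_one_of_one_lt_of_neg one_lt_two (by linarith)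
  have hβn : ∀ n : ℕ, β ^ n = 2 ^ ((n : ℝ) * R) * 2 ^ ((n : ℝ) * H) / (Fintype.card F : ℝ) ^ n :=
    fun n => by
      rw [hqn, ← Real.rpow_add zero_lt_two, ← Real.rpow_sub zero_lt_two, hβ,
        ← Real.rpow_mul_natCast zero_le_two]
      ring_nf
  have hone : ∀ n, (1 : ℝ) ≤ (Fintype.card F : ℝ) ^ r n := fun n => one_le_pow₀ hq1.le
  have hp : ∀ a, 0 ≤ (p a).toReal := fun a => ENNReal.toReal_nonneg
  refine ⟨r, T, fun n => ?_, fun n => ?_, ?_⟩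
  · rw [← div_le_iff₀ hLpos]
    exact Nat.le_ceil _
  · refine Nat.ceil_le.2 ?_
    rw [div_le_iff₀ hLpos]
    exact mul_le_mul_of_nonneg_left (by linarith) (Nat.cast_nonneg n)
  · have hlim : Tendsto (fun n : ℕ => ρ ^ n + Fintype.card F * β ^ n + Fintype.card F * β ^ n) atTop
        (𝓝 0) := by
      have h1 := tendsto_pow_atTop_nhds_zero_of_lt_one hρ0 hρ1
      have h2 := (tendsto_pow_atTop_nhds_zero_of_lt_one hβ0 hβ1).const_mul (Fintype.card F : ℝ)
      simpa using (h1.add h2).add h2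
    refine squeeze_zero (fun n => ?_) (fun n => ?_) hlim
    · have := hone n
      refine add_nonneg (add_nonneg (Finset.sum_nonneg fun u _ => blockMass_nonneg hp u)
        (mul_nonneg (by linarith) (by positivity))) (by positivity)
    · rw [meanBound]
      refine add_le_add (add_le_add (hT1 n) ?_) ?_
      · rw [hβn, ← mul_div_assoc, ← mul_div_assoc, ← mul_assoc]
        gcongr
        · linarith [hrq n]
        · exact hT2 n
      · rw [hβn, ← mul_div_assoc, ← mul_assoc]
        gcongr
        -- The rank term lacks the factor `2 ^ (n H)`, which is at least `1`.
        exact (hrq n).trans (le_mul_of_one_le_right (by positivity)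
          (Real.one_le_rpow one_le_two (by positivity)))

/-- There are codes of every length whose error probabilities are small if the average union bounds
and the probability of rank deficiency are. -/
lemma exists_precodedLinear {F : Type*} [Field F] [Fintype F]
    {Q : Matrix (Fin 2) (Fin 2) F} (P : PMF (Fin 2 → F)) {m : Fin 3 → F} (hm : IsZeroForcing Q m)
    {n : ℕ} {r : Fin 2 → ℕ} (hr : ∀ k, r k ≤ n) (T : Fin 2 → Finset (Fin n → F)) {b : ℝ}
    (hb : ∑ k, (meanBound (fun a => (marginal P k a).toReal) (r k) (T k) +
      (Fintype.card F : ℝ) ^ r k / (Fintype.card F : ℝ) ^ n) ≤ b) :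
    ∃ c : Code F n r, IsPrecodedLinear m c ∧
      (b < 1 → ∀ k, errorProb Q P c.encode c.dec k ≤ b) := by
  by_cases hb1 : b < 1
  · obtain ⟨G, hG, hG'⟩ := exists_generator r
      (fun k a => (marginal P k a).toReal) (fun _ _ => ENNReal.toReal_nonneg)
      (fun k => sum_toReal _) hm.desiredCoeff_ne_zero T hb1 hb
    exact ⟨precodedCode Q m T G, isPrecodedLinear_precodedCode Q m T hG,
      fun _ k => (errorProb_precodedCode_le P hm T G k).trans (hG' k)⟩
  · obtain ⟨G, hG⟩ := exists_linearIndependent_row F (max_le (hr 0) (hr 1))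
    exact ⟨precodedCode Q m T G, isPrecodedLinear_precodedCode Q m T hG,
      fun hlt => absurd hlt hb1⟩

/-- Direct part: rates below the single-user capacities are achieved by distributed
zero-forcing. -/
lemma achievableBy_isPrecodedLinear {F : Type*} [Field F] [Fintype F]
    {Q : Matrix (Fin 2) (Fin 2) F} (P : PMF (Fin 2 → F)) {m : Fin 3 → F} (hm : IsZeroForcing Q m)
    {R : Fin 2 → ℝ} (hR : ∀ k, 0 ≤ R k) (h : ∀ k, R k = 0 ∨
      R k < Real.logb 2 (Fintype.card F) - entropy (marginal P k)) :
    AchievableBy Q P (fun c => IsPrecodedLinear m c) R := by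
  choose r T h1 h2 h3 using fun k => exists_meanBound_tendsto (marginal P k) (hR k) (h k)
  set b : ℕ → ℝ := fun n => ∑ k, (meanBound (fun a => (marginal P k a).toReal) (r k n) (T k n) +
    (Fintype.card F : ℝ) ^ r k n / (Fintype.card F : ℝ) ^ n) with hb
  have hb0 : Tendsto b atTop (𝓝 0) := by
    simpa only [Finset.sum_const_zero] using tendsto_finsetSum Finset.univ fun k _ => h3 k
  choose c hc1 hc2 using fun n => exists_precodedLinear P hm (r := fun k => r k n)
    (fun k => h2 k n) (fun k => T k n) (b := b n) le_rfl
  refine ⟨hR, fun n k => r k n, c, hc1, fun n k => h1 k n, fun k => ?_⟩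
  refine squeeze_zero' (Eventually.of_forall fun n => errorProb_nonneg _ _ _ _ _) ?_ hb0
  filter_upwards [hb0.eventually_lt_const one_pos] with n hn
  exact hc2 n hn k

/-! ### The capacity region -/

lemma AchievableBy.mono {F : Type*} [Field F] [Fintype F] {Q : Matrix (Fin 2) (Fin 2) F}
    {P : PMF (Fin 2 → F)} {S S' : ∀ {n : ℕ} {r : Fin 2 → ℕ}, Code F n r → Prop} {R : Fin 2 → ℝ}
    (hR : AchievableBy Q P S R) (h : ∀ {n : ℕ} {r : Fin 2 → ℕ} (c : Code F n r), S c → S' c) :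
    AchievableBy Q P S' R := by
  obtain ⟨h0, r, c, hS, hrest⟩ := hR
  exact ⟨h0, r, c, fun n => h _ (hS n), hrest⟩

/-- A box is contained in the closure of its half-open part. -/
lemma box_subset_closure {ι : Type*} (C : ι → ℝ) :
    {R : ι → ℝ | ∀ k, 0 ≤ R k ∧ R k ≤ C k} ⊆
      closure {R | (∀ k, 0 ≤ R k) ∧ ∀ k, R k = 0 ∨ R k < C k} := by
  intro R hR
  -- Shrinking towards the origin makes positive coordinates strictly admissible and keeps zero ones
  -- zero, which is why `R k = 0` is a separate alternative.
  have hlim : Tendsto (fun s : ℝ => s • R) (𝓝[<] 1) (𝓝 R) := by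
    have : Tendsto (fun s : ℝ => s • R) (𝓝 1) (𝓝 ((1 : ℝ) • R)) :=
      (continuous_id.smul continuous_const).tendsto 1
    rw [one_smul] at this
    exact this.mono_left nhdsWithin_le_nhds
  refine mem_closure_of_tendsto hlim ?_
  filter_upwards [Ioo_mem_nhdsLT (zero_lt_one (α := ℝ))] with s hs
  refine ⟨fun k => mul_nonneg hs.1.le (hR k).1, fun k => ?_⟩
  rcases (hR k).1.eq_or_lt with h0 | h0
  · exact Or.inl (by simp [← h0])
  · refine Or.inr (lt_of_lt_of_le ?_ (hR k).2)
    simpa using mul_lt_of_lt_one_left h0 hs.2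

lemma isClosed_box {ι : Type*} (C : ι → ℝ) :
    IsClosed {R : ι → ℝ | ∀ k, 0 ≤ R k ∧ R k ≤ C k} := by
  simp only [Set.ofPred_forall, Set.ofPred_and]
  exact isClosed_iInter fun k => (isClosed_le continuous_const (continuous_apply k)).inter
    (isClosed_le (continuous_apply k) continuous_const)

end NetworkCodedCIC

open NetworkCodedCIC in
theorem mainTheorem2 {F : Type*} [Field F] [Fintype F] (Q : Matrix (Fin 2) (Fin 2) F)
    (P : PMF (Fin 2 → F)) (hQ : Q.det ≠ 0) (h11 : Q 0 0 ≠ 0) (h21 : Q 1 0 ≠ 0) :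
    NetworkCodedCIC.capacityRegion Q P =
        {R | ∀ k, 0 ≤ R k ∧ R k ≤ Real.logb 2 (Fintype.card F) -
          NetworkCodedCIC.entropy (NetworkCodedCIC.marginal P k)} ∧
      NetworkCodedCIC.capacityRegion Q P = NetworkCodedCIC.bcCapacityRegion Q P ∧
      ∃ m : Fin 3 → F, NetworkCodedCIC.IsZeroForcing Q m ∧
        NetworkCodedCIC.precodingRegion Q P m = NetworkCodedCIC.capacityRegion Q P := by
  obtain ⟨m, hm⟩ := exists_isZeroForcing hQ h11 h21
  set B : Set (Fin 2 → ℝ) := {R | ∀ k, 0 ≤ R k ∧ R k ≤ Real.logb 2 (Fintype.card F) -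
    entropy (marginal P k)} with hB
  have hBP : B ⊆ precodingRegion Q P m := (box_subset_closure _).trans
    (closure_mono fun R hR => achievableBy_isPrecodedLinear P hm hR.1 hR.2)
  have hPC : precodingRegion Q P m ⊆ capacityRegion Q P :=
    closure_mono fun R hR =>
      AchievableBy.mono (S := fun c => IsPrecodedLinear m c) hR fun _ _ => trivial
  have hCW : capacityRegion Q P ⊆ bcCapacityRegion Q P :=
    closure_mono fun R hR => AchievableBy.bcAchievable (S := fun _ => True) hR
  have hWB : bcCapacityRegion Q P ⊆ B :=
    closure_minimal (fun R hR k => ⟨hR.1 k, BCAchievable.le hR k⟩) (isClosed_box _)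
  exact ⟨(hCW.trans hWB).antisymm (hBP.trans hPC), hCW.antisymm (hWB.trans (hBP.trans hPC)), m, hm,
    hPC.antisymm ((hCW.trans hWB).trans hBP)⟩
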